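/- Let $D$ be a random element of a measurable space $\mathcal D$ (the data) defined on a probability space with probability $\mathrm{pr}_P$. Let $\mathcal S$ be a measurable space of objects that can be selected, let $\theta_s\in\mathbb R$ be the population target attached to $s\in\mathcal S$ (under $P$), and let $C_s(D)\subseteq\mathbb R$ be confidence sets such that the noncoverage set $\{(s,d):\theta_s\notin C_s(d)\}$ is measurable in $\mathcal S\times\mathcal D$. Let $q\ge 1$, $\tau>0$, let $T:\mathcal D\to\mathbb R^q$ be measurable, let $\xi\sim N(0,\tau^2I_q)$ be independent of $D$, and put $W=T(D)+\xi$. Let $U$ be a random element of a measurable space, independent of $(D,\xi)$, and let $S^\star=\mathcal A(W,U)$, where $\mathcal A$ is an arbitrary measurable map into $\mathcal S$. Assume that the covariance matrix $\Sigma_T=\operatorname{cov}_P\{T(D)\}$ exists, that is, $T(D)$ is square integrable. If, for some $\alpha\in\mathbb R$, \[ \mathrm{pr}_P\{\theta_s\notin C_s(D)\}\le\alpha\qquad\text{for every fixed } s\in\mathcal S, \] then \[ \mathrm{pr}_P\{\theta_{S^\star}\notin C_{S^\star}(D)\}\le\alpha+\Bigl[\tfrac14\log\det\{I_q+\tau^{-2}\Sigma_T\}\Bigr]^{1/2}.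 \] In particular, if $\operatorname{tr}\Sigma_T\le v$, then \[ \mathrm{pr}_P\{\theta_{S^\star}\notin C_{S^\star}(D)\}\le\alpha+\Bigl[\tfrac q4\log\Bigl\{1+\frac{v}{q\tau^2}\Bigr\}\Bigr]^{1/2}. \] -/

import Mathlib

open MeasureTheory ProbabilityTheory

/-- The covariance matrix of a random vector `X` in `ℝ^q`; it is meaningful when the coordinates of
`X` are square integrable. -/
noncomputable def covarianceMatrix {Ω : Type*} [MeasurableSpace Ω] {q : ℕ}
    (X : Ω → EuclideanSpace ℝ (Fin q)) (P : Measure Ω) : Matrix (Fin q) (Fin q) ℝ :=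
  Matrix.of fun i j => covariance (fun ω => X ω i) (fun ω => X ω j) P

/-- The object selected from the noisy summary `W = T(D) + ξ` and the randomization `U`, that is,
`S⋆ = 𝒜(W, U)`. -/
noncomputable def noisySelection {Ω 𝓓 𝓤 𝓢 : Type*} {q : ℕ} (D : Ω → 𝓓)
    (T : 𝓓 → EuclideanSpace ℝ (Fin q)) (ξ : Ω → EuclideanSpace ℝ (Fin q)) (U : Ω → 𝓤)
    (A : EuclideanSpace ℝ (Fin q) × 𝓤 → 𝓢) : Ω → 𝓢 :=
  fun ω => A (T (D ω) + ξ ω, U ω)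

/-!
The selected object `S⋆` depends on the data `D` only through `W = T(D) + ξ` and the independent
randomization. If `W` were independent of `D`, the noncoverage probability at `S⋆` would be at most
`α`, by conditioning on the selection. This holds for every law of the independent copy of `W`, so
the law is chosen for convenience: a product of Gaussian laws, in the coordinates of a suitable
orthonormal basis, with the means and variances of the coordinates of `W`.

The price of the replacement is bounded by Pinsker's inequality
(`measureReal_le_add_sqrt_of_withDensity_exp_neg`), for which the log-likelihood ratio is explicit:
given `D`, the coordinates of `W` are independent Gaussian. The quadratic terms of the log-likelihood
ratio cancel in expectation (`integral_gaussianLogRatio_add`) and the divergence is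
`∑ i, log (1 + Var (X i) / τ²) / 2`, where `X i` are the coordinates of `T(D)`; see
`map_prod_add_pi_gaussianReal_real_le`. No conditional expectations, differential entropies or
mutual information are needed.

The basis is free (`selection_noncoverage_le_of_orthonormalBasis`). An eigenbasis of `1 + τ⁻² Σ`
gives the log-determinant, and the standard basis together with Jensen's inequality
(`sum_log_one_add_div_le`) gives the trace bound.
-/

/-! ### Comparison of probabilities through an explicit likelihood ratio -/

/-- A one-sided Pinsker inequality. If `dQ/dπ = exp (-l)`, then `∫ l dπ` is the Kullback-Leibler
divergence of `π` from `Q`, and `π B - Q B` is at most the square root of half of it. The proof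
combines the Donsker-Varadhan bound for the indicator of `B` with Hoeffding's lemma. -/
theorem measureReal_le_add_sqrt_of_withDensity_exp_neg {X : Type*} [MeasurableSpace X]
    {π Q : Measure X} [IsProbabilityMeasure π] [IsProbabilityMeasure Q] {l : X → ℝ}
    (hl : Measurable l) (hint : Integrable l π)
    (hQ : Q = π.withDensity fun x => ENNReal.ofReal (Real.exp (-l x)))
    {B : Set X} (hB : MeasurableSet B) :
    π.real B ≤ Q.real B + √((1 / 2) * ∫ x, l x ∂π) := by
  set δ := π.real B - Q.real B with hδ
  rcases le_or_gt δ 0 with h0 | h0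
  · have := Real.sqrt_nonneg ((1 / 2) * ∫ x, l x ∂π)
    linarith
  set f : X → ℝ := B.indicator 1 with hf
  have hfm : Measurable f := measurable_one.indicator hB
  have hfQ : ∫ x, f x ∂Q = Q.real B := integral_indicator_one hB
  have hfπ : ∫ x, f x ∂π = π.real B := integral_indicator_one hB
  have hmem : ∀ x, f x ∈ Set.Icc (0 : ℝ) 1 := fun x => by
    by_cases hx : x ∈ B <;> simp [hf, hx]
  have hfi : Integrable f π :=
    Integrable.of_mem_Icc 0 1 hfm.aemeasurable (Filter.Eventually.of_forall hmem)
  have hsub := hasSubgaussianMGF_of_mem_Icc (μ := Q) hfm.aemeasurable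
    (Filter.Eventually.of_forall hmem)
  rw [hfQ] at hsub
  -- `λ = 4δ` maximizes `λδ - λ²/8`. Hoeffding's lemma bounds the exponential moment of
  -- `λ(1_B - Q B)` under `Q` by `exp (λ²/8) = exp (2δ²)`.
  have hmgf := hsub.mgf_le (4 * δ)
  have hexp := hsub.integrable_exp_mul (4 * δ)
  have hdens : Measurable fun x => ENNReal.ofReal (Real.exp (-l x)) := by fun_prop
  have hlt : ∀ᵐ x ∂π, ENNReal.ofReal (Real.exp (-l x)) < ⊤ := by simp
  rw [mgf, hQ, integral_withDensity_eq_integral_toReal_smul hdens hlt] at hmgf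
  rw [hQ, integrable_withDensity_iff_integrable_smul' hdens hlt] at hexp
  rw [← hQ] at hmgf hexp
  simp only [smul_eq_mul, ENNReal.toReal_ofReal (Real.exp_nonneg _)] at hmgf hexp
  -- The tangent inequality `y + 1 ≤ exp y` at `y = λ(1_B - Q B) - l - 2δ²`, to be integrated
  -- against `π`.
  have hpt : ∀ x, 4 * δ * (f x - Q.real B) - l x - 2 * δ ^ 2 + 1 ≤
      Real.exp (-(2 * δ ^ 2)) *
        (Real.exp (-l x) * Real.exp (4 * δ * (f x - Q.real B))) := fun x => by
    rw [← Real.exp_add, ← Real.exp_add]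
    exact (Real.add_one_le_exp _).trans (Real.exp_le_exp.2 (by linarith))
  have hI := integral_mono (μ := π) (by fun_prop) (hexp.const_mul _) hpt
  have hL : ∫ x, (4 * δ * (f x - Q.real B) - l x - 2 * δ ^ 2 + 1) ∂π =
      4 * δ * δ - ∫ x, l x ∂π - 2 * δ ^ 2 + 1 := by
    rw [integral_add (by fun_prop) (by fun_prop), integral_sub (by fun_prop) (by fun_prop),
      integral_sub (by fun_prop) hint, integral_const_mul,
      integral_sub hfi (by fun_prop), hfπ]
    simp [hδ]
  rw [hL, integral_const_mul] at hI
  have hc : Real.exp ((((‖(1 : ℝ) - 0‖₊ / 2) ^ 2 : NNReal) : ℝ) * (4 * δ) ^ 2 / 2) =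
      Real.exp (2 * δ ^ 2) := by
    congr 1; simp; ring
  rw [hc] at hmgf
  have h1 := hI.trans (mul_le_mul_of_nonneg_left hmgf (Real.exp_nonneg _))
  rw [← Real.exp_add, neg_add_cancel, Real.exp_zero] at h1
  have : δ ≤ √((1 / 2) * ∫ x, l x ∂π) := Real.le_sqrt_of_sq_le (by nlinarith)
  linarith

/-! ### Likelihood ratios of Gaussian measures -/

/-- A product of measures with densities has the product density. -/
theorem pi_withDensity_eq_withDensity_prod {ι : Type*} [Fintype ι] {X : ι → Type*}
    [∀ i, MeasurableSpace (X i)] (μ : ∀ i, Measure (X i)) [∀ i, IsProbabilityMeasure (μ i)]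
    {f : ∀ i, X i → ENNReal} (hf : ∀ i, Measurable (f i))
    [∀ i, SigmaFinite ((μ i).withDensity (f i))] :
    Measure.pi (fun i => (μ i).withDensity (f i)) =
      (Measure.pi μ).withDensity fun x => ∏ i, f i (x i) := by
  refine Measure.pi_eq fun s hs => ?_
  rw [withDensity_apply _ (MeasurableSet.univ_pi hs), ← lintegral_indicator (.univ_pi hs)]
  have hind : ∀ x, (Set.univ.pi s).indicator (fun x => ∏ i, f i (x i)) x =
      ∏ i, (s i).indicator (f i) (x i) := fun x => by
    by_cases hx : x ∈ Set.univ.pi s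
    · rw [Set.indicator_of_mem hx]
      exact Finset.prod_congr rfl fun i _ => (Set.indicator_of_mem (hx i trivial) _).symm
    · rw [Set.indicator_of_notMem hx]
      obtain ⟨i, hi⟩ : ∃ i, x i ∉ s i := by simpa [Set.mem_univ_pi] using hx
      exact (Finset.prod_eq_zero (Finset.mem_univ i) (Set.indicator_of_notMem hi _)).symm
  simp_rw [hind]
  have hm : ∀ i, Measurable ((s i).indicator (f i)) := fun i => (hf i).indicator (hs i)
  have hind' := iIndepFun_pi (μ := μ) (X := fun i => (s i).indicator (f i))
    fun i => (hm i).aemeasurable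
  rw [lintegral_prod_eq_prod_lintegral_of_indepFun Finset.univ
    (fun i (x : ∀ i, X i) => (s i).indicator (f i) (x i)) hind'
    fun i => (hm i).comp (measurable_pi_apply i)]
  refine Finset.prod_congr rfl fun i _ => ?_
  rw [withDensity_apply _ (hs i), ← lintegral_indicator (hs i)]
  exact (measurePreserving_eval μ i).lintegral_comp (hm i)

/-- The logarithm of the density at `x` of `N(t, v)` with respect to `N(m, w)`. The parameters `v`
and `w` are the variances, assumed nonzero wherever the definition is used. -/
noncomputable def gaussianLogRatio (t m : ℝ) (v w : NNReal) (x : ℝ) : ℝ :=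
  Real.log (w / v) / 2 - (x - t) ^ 2 / (2 * v) + (x - m) ^ 2 / (2 * w)

theorem gaussianReal_eq_withDensity_exp_neg_gaussianLogRatio (t m : ℝ) {v w : NNReal}
    (hv : v ≠ 0) (hw : w ≠ 0) :
    gaussianReal m w = (gaussianReal t v).withDensity
      fun x => ENNReal.ofReal (Real.exp (-gaussianLogRatio t m v w x)) := by
  have hlm : Measurable (gaussianLogRatio t m v w) := by unfold gaussianLogRatio; fun_prop
  rw [gaussianReal_of_var_ne_zero _ hv, gaussianReal_of_var_ne_zero _ hw,
    ← withDensity_mul _ (measurable_gaussianPDF _ _) (by fun_prop)]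
  congr 1
  ext x
  rw [Pi.mul_apply, gaussianPDF, gaussianPDF, ← ENNReal.ofReal_mul (gaussianPDFReal_nonneg _ _ _)]
  congr 1
  have hv' : (0 : ℝ) < v := by positivity
  have hw' : (0 : ℝ) < w := by positivity
  have hs : Real.exp (-(Real.log (w / v) / 2)) = √v / √w := by
    rw [← neg_div, ← Real.log_inv, ← Real.log_sqrt (by positivity), Real.exp_log (by positivity),
      inv_div, Real.sqrt_div hv'.le]
  rw [gaussianPDFReal, gaussianPDFReal, gaussianLogRatio,
    show -(Real.log (w / v) / 2 - (x - t) ^ 2 / (2 * v) + (x - m) ^ 2 / (2 * w)) =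
      -(Real.log (w / v) / 2) + (x - t) ^ 2 / (2 * v) + -(x - m) ^ 2 / (2 * w) by ring,
    Real.exp_add, Real.exp_add, hs, Real.sqrt_mul (by positivity) (v : ℝ),
    Real.sqrt_mul (by positivity) (w : ℝ), neg_div _ ((x - t) ^ 2), Real.exp_neg]
  field_simp

/-! ### Information through an additive Gaussian channel -/

/-- The expected log-likelihood ratio between the conditional law `N(f, v)` of `f + g` given `f` and
the Gaussian law whose mean and variance are those of `f + g`. With this reference law the two
quadratic terms have the same expectation `1 / 2` and cancel. -/
theorem integral_gaussianLogRatio_add {X : Type*} [MeasurableSpace X] {ρ : Measure X}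
    [IsProbabilityMeasure ρ] {f g : X → ℝ} (hf : MemLp f 2 ρ) {v w : NNReal} (hv : v ≠ 0)
    (hg : HasLaw g (gaussianReal 0 v) ρ) (hfg : IndepFun f g ρ) (hw : w = Var[f; ρ] + v) :
    Integrable (fun x => gaussianLogRatio (f x) (∫ y, f y ∂ρ) v w (f x + g x)) ρ ∧
      ∫ x, gaussianLogRatio (f x) (∫ y, f y ∂ρ) v w (f x + g x) ∂ρ =
        Real.log (1 + Var[f; ρ] / v) / 2 := by
  have hv' : (v : ℝ) ≠ 0 := by exact_mod_cast hv
  have hvpos : (0 : ℝ) < v := by positivity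
  have hwpos : (0 : ℝ) < w := by rw [hw]; linarith [variance_nonneg f ρ]
  have hid : MemLp id 2 (ρ.map g) := by rw [hg.map_eq]; exact memLp_id_gaussianReal 2
  have hg2 : MemLp g 2 ρ := by simpa using hid.comp_of_map hg.aemeasurable
  have hg0 : ∫ x, g x ∂ρ = 0 := by simpa using hg.integral_eq
  have hgv : Var[g; ρ] = v := by simpa using hg.variance_eq
  have hgsq : ∫ x, g x ^ 2 ∂ρ = v := by
    rw [← hgv, variance_of_integral_eq_zero hg.aemeasurable hg0]
  have hsum : ∫ x, (f x + g x - ∫ y, f y ∂ρ) ^ 2 ∂ρ = w := by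
    have h := hfg.variance_add hf hg2
    rw [hgv, ← hw, variance_eq_integral (hf.add hg2).aemeasurable] at h
    simpa [integral_add (hf.integrable one_le_two) (hg2.integrable one_le_two), hg0] using h
  have hi1 : Integrable (fun x => g x ^ 2 / (2 * v)) ρ := hg2.integrable_sq.div_const _
  have hi2 : Integrable (fun x => (f x + g x - ∫ y, f y ∂ρ) ^ 2 / (2 * w)) ρ :=
    ((hf.add hg2).sub (memLp_const _)).integrable_sq.div_const _
  simp only [gaussianLogRatio, add_sub_cancel_left]
  have hi3 : Integrable (fun x => Real.log (w / v) / 2 - g x ^ 2 / (2 * v)) ρ :=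
    (integrable_const _).sub hi1
  refine ⟨hi3.add hi2, ?_⟩
  rw [integral_add hi3 hi2, integral_sub (integrable_const _) hi1,
    integral_const, integral_div, integral_div, hgsq, hsum]
  have h1 : (w : ℝ) / v = 1 + Var[f; ρ] / v := by rw [hw]; field_simp; ring
  rw [h1, div_mul_cancel_right₀ hv', div_mul_cancel_right₀ hwpos.ne']
  simp

theorem measurable_gaussianLogRatio {X : Type*} [MeasurableSpace X] {t x : X → ℝ}
    (ht : Measurable t) (hx : Measurable x) (m : ℝ) (v w : NNReal) :
    Measurable fun y => gaussianLogRatio (t y) m v w (x y) := by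
  unfold gaussianLogRatio; fun_prop

theorem pi_gaussianReal_eq_withDensity {ι : Type*} [Fintype ι] (t m : ι → ℝ) {v : NNReal}
    {w : ι → NNReal} (hv : v ≠ 0) (hw : ∀ i, w i ≠ 0) :
    Measure.pi (fun i => gaussianReal (m i) (w i)) =
      (Measure.pi fun i => gaussianReal (t i) v).withDensity
        fun x => ENNReal.ofReal (Real.exp (-∑ i, gaussianLogRatio (t i) (m i) v (w i) (x i))) := by
  have h i := gaussianReal_eq_withDensity_exp_neg_gaussianLogRatio (t i) (m i) hv (hw i)
  have (i : ι) : SigmaFinite ((gaussianReal (t i) v).withDensity fun x =>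
      ENNReal.ofReal (Real.exp (-gaussianLogRatio (t i) (m i) v (w i) x))) := by
    rw [← h i]; infer_instance
  simp_rw [h]
  rw [pi_withDensity_eq_withDensity_prod]
  · congr 1
    ext x
    rw [← ENNReal.ofReal_prod_of_nonneg fun i _ => (Real.exp_nonneg _), ← Real.exp_sum,
      Finset.sum_neg_distrib]
  · intro i
    have := measurable_gaussianLogRatio (measurable_const (a := t i)) measurable_id (m i) v (w i)
    simp only [id] at this
    fun_prop

/-- Observing `X y` in white Gaussian noise of variance `v` makes the pair (input, observation)
nearly independent: its law exceeds the product of the input law with a fixed law `γ` by at most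
the square root of half of the capacity bound `∑ i, log (1 + Var (X i) / v) / 2`. The measure `γ`
is the product of the Gaussian laws with the means and variances of the coordinates of the
observation; it need not be the law of the observation, whose coordinates may be correlated and
non-Gaussian. -/
theorem map_prod_add_pi_gaussianReal_real_le {𝓨 ι : Type*} [MeasurableSpace 𝓨] [Fintype ι]
    (μ : Measure 𝓨) [IsProbabilityMeasure μ] {X : 𝓨 → ι → ℝ} (hX : Measurable X)
    (hX2 : ∀ i, MemLp (fun y => X y i) 2 μ) {v : NNReal} (hv : v ≠ 0) :
    ∃ γ : Measure (ι → ℝ), IsProbabilityMeasure γ ∧ ∀ B : Set (𝓨 × (ι → ℝ)), MeasurableSet B →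
      ((μ.prod (Measure.pi fun _ => gaussianReal 0 v)).map fun p => (p.1, X p.1 + p.2)).real B ≤
        (μ.prod γ).real B +
          √((1 / 4) * ∑ i, Real.log (1 + Var[fun y => X y i; μ] / v)) := by
  set N : Measure (ι → ℝ) := Measure.pi fun _ => gaussianReal 0 v
  let m : ι → ℝ := fun i => ∫ y, X y i ∂μ
  let w : ι → NNReal := fun i => Var[fun y => X y i; μ].toNNReal + v
  have hw : ∀ i, w i ≠ 0 := fun i => by simp [w, hv]
  have hwr : ∀ i, (w i : ℝ) = Var[fun y => X y i; μ] + v := fun i => by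
    simp [w, variance_nonneg]
  let Γ : Measure (ι → ℝ) := Measure.pi fun i => gaussianReal (m i) (w i)
  refine ⟨Γ, inferInstance, fun B hB => ?_⟩
  have hφ : Measurable fun p : 𝓨 × (ι → ℝ) => (p.1, X p.1 + p.2) := by fun_prop
  let l : 𝓨 × (ι → ℝ) → ℝ := fun p => ∑ i, gaussianLogRatio (X p.1 i) (m i) v (w i) (p.2 i)
  have hl : Measurable l := Finset.measurable_sum _ fun i _ =>
    measurable_gaussianLogRatio (by fun_prop) (by fun_prop) _ _ _
  have hterm : ∀ i, Integrable (fun p : 𝓨 × (ι → ℝ) =>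
        gaussianLogRatio (X p.1 i) (m i) v (w i) (X p.1 i + p.2 i)) (μ.prod N) ∧
      ∫ p, gaussianLogRatio (X p.1 i) (m i) v (w i) (X p.1 i + p.2 i) ∂(μ.prod N) =
        Real.log (1 + Var[fun y => X y i; μ] / v) / 2 := fun i => by
    have hfst : MeasurePreserving Prod.fst (μ.prod N) μ := measurePreserving_fst
    have hXi : Measurable fun y => X y i := by fun_prop
    have hvar : Var[fun p : 𝓨 × (ι → ℝ) => X p.1 i; μ.prod N] = Var[fun y => X y i; μ] :=
      hfst.variance_fun_comp hXi.aemeasurable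
    have hmean : ∫ p : 𝓨 × (ι → ℝ), X p.1 i ∂(μ.prod N) = m i := by
      rw [integral_fun_fst (μ := μ) (ν := N) (fun y => X y i)]; simp [m]
    have hlaw : HasLaw (fun p : 𝓨 × (ι → ℝ) => p.2 i) (gaussianReal 0 v) (μ.prod N) :=
      ((measurePreserving_eval (fun _ => gaussianReal 0 v) i).comp
        (measurePreserving_snd (μ := μ))).hasLaw
    have := integral_gaussianLogRatio_add (ρ := μ.prod N) (f := fun p => X p.1 i) (w := w i)
      ((hX2 i).comp_measurePreserving hfst) hv hlaw
      (indepFun_prod hXi (measurable_pi_apply i)) (by rw [hvar, hwr])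
    rwa [hmean, hvar] at this
  have hint : Integrable l ((μ.prod N).map fun p => (p.1, X p.1 + p.2)) := by
    rw [integrable_map_measure hl.aestronglyMeasurable hφ.aemeasurable]
    exact integrable_finsetSum _ fun i _ => (hterm i).1
  have hkl : ∫ p, l p ∂((μ.prod N).map fun p => (p.1, X p.1 + p.2)) =
      (1 / 2) * ∑ i, Real.log (1 + Var[fun y => X y i; μ] / v) := by
    rw [integral_map hφ.aemeasurable hl.aestronglyMeasurable]
    refine (integral_finsetSum _ fun i _ => (hterm i).1).trans ?_
    rw [Finset.mul_sum]
    exact Finset.sum_congr rfl fun i _ => (hterm i).2.trans (by ring)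
  have hdens : μ.prod Γ = ((μ.prod N).map fun p => (p.1, X p.1 + p.2)).withDensity
      fun p => ENNReal.ofReal (Real.exp (-l p)) := by
    have hexp : Measurable fun p => ENNReal.ofReal (Real.exp (-l p)) := by fun_prop
    ext S hS
    have hpull : Measurable fun p : 𝓨 × (ι → ℝ) =>
        S.indicator (fun p => ENNReal.ofReal (Real.exp (-l p))) (p.1, X p.1 + p.2) :=
      (hexp.indicator hS).comp hφ
    rw [withDensity_apply _ hS, ← lintegral_indicator hS, lintegral_map (hexp.indicator hS) hφ,
      lintegral_prod _ hpull.aemeasurable, Measure.prod_apply hS]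
    refine lintegral_congr fun y => ?_
    -- Given `y`, the observation has law `∏ i, N(X y i, v)`, with log-density `l (y, ·)` relative
    -- to `Γ`, so the identity holds fibrewise.
    have hshift : N.map (fun z => X y + z) = Measure.pi fun i => gaussianReal (X y i) v := by
      have := Measure.pi_map_pi (μ := fun _ : ι => gaussianReal 0 v)
        (f := fun i z => X y i + z) fun i => by fun_prop
      simp_rw [gaussianReal_map_const_add, zero_add] at this
      exact this
    have hslice : MeasurableSet (Prod.mk y ⁻¹' S) := measurable_prodMk_left hS
    rw [show Γ = _ from pi_gaussianReal_eq_withDensity (X y) m hv hw, ← hshift,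
      withDensity_apply _ hslice, ← lintegral_indicator hslice, lintegral_map _ (by fun_prop)]
    · rfl
    · exact (hexp.comp measurable_prodMk_left).indicator hslice
  have : IsProbabilityMeasure ((μ.prod N).map fun p => (p.1, X p.1 + p.2)) :=
    Measure.isProbabilityMeasure_map hφ.aemeasurable
  have hfin := measureReal_le_add_sqrt_of_withDensity_exp_neg hl hint hdens hB
  rwa [hkl, ← mul_assoc, show (1 / 2 : ℝ) * (1 / 2) = 1 / 4 by norm_num] at hfin

/-! ### Gaussian noise and covariance in an orthonormal basis -/

open scoped MatrixOrder in
/-- The coordinates of isotropic Gaussian noise in any orthonormal basis are independent. -/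
theorem multivariateGaussian_smul_one_eq_map_pi {ι : Type*} [Fintype ι] [DecidableEq ι]
    (b : OrthonormalBasis ι ℝ (EuclideanSpace ℝ ι)) {τ : ℝ} (hτ : 0 ≤ τ) :
    multivariateGaussian 0 (τ ^ 2 • (1 : Matrix ι ι ℝ)) =
      (Measure.pi fun _ : ι => gaussianReal 0 (τ ^ 2).toNNReal).map fun x => ∑ i, x i • b i := by
  have hsqrt : CFC.sqrt (τ ^ 2 • (1 : Matrix ι ι ℝ)) = τ • 1 := by
    refine CFC.sqrt_unique ?_ ?_
    · rw [smul_mul_smul_comm, mul_one, sq]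
    · exact smul_nonneg hτ zero_le_one
  have hscale := Measure.pi_map_pi (μ := fun _ : ι => gaussianReal 0 1)
    (f := fun _ z => τ * z) fun i => by fun_prop
  simp_rw [gaussianReal_map_const_mul, mul_zero, mul_one] at hscale
  have hv : NNReal.mk (τ ^ 2) (sq_nonneg τ) = (τ ^ 2).toNNReal :=
    (Real.toNNReal_of_nonneg _).symm
  rw [hv] at hscale
  rw [multivariateGaussian, hsqrt, stdGaussian_eq_map_pi_orthonormalBasis b, ← hscale,
    Measure.map_map (by fun_prop) (by fun_prop), Measure.map_map (by fun_prop) (by fun_prop)]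
  congr 1
  ext1 x
  simp [Finset.smul_sum, smul_smul]

theorem variance_inner_eq_dotProduct_covarianceMatrix {Ω : Type*} [MeasurableSpace Ω]
    {P : Measure Ω} [IsProbabilityMeasure P] {q : ℕ} {Y : Ω → EuclideanSpace ℝ (Fin q)}
    (hY : MemLp Y 2 P) (a : EuclideanSpace ℝ (Fin q)) :
    Var[fun ω => inner ℝ a (Y ω); P] = a.ofLp ⬝ᵥ (covarianceMatrix Y P).mulVec a.ofLp := by
  have hYi : ∀ i, MemLp (fun ω => Y ω i) 2 P := fun i => by
    simpa using hY.continuousLinearMap_comp (EuclideanSpace.proj (𝕜 := ℝ) i)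
  have hinner : ∀ ω, inner ℝ a (Y ω) = ∑ i, a i * Y ω i := fun ω => by
    simp [PiLp.inner_apply, mul_comm]
  simp_rw [hinner]
  have hm : ∀ i, MemLp (fun ω => a i * Y ω i) 2 P := fun i => (hYi i).const_mul _
  rw [← covariance_self (memLp_finsetSum _ fun i _ => hm i).aemeasurable,
    covariance_fun_sum_fun_sum hm hm]
  simp_rw [covariance_const_mul_left, covariance_const_mul_right]
  simp only [dotProduct, Matrix.mulVec, covarianceMatrix, Matrix.of_apply, Finset.mul_sum]
  refine Finset.sum_congr rfl fun i _ => Finset.sum_congr rfl fun j _ => by ring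

theorem covarianceMatrix_isHermitian {Ω : Type*} [MeasurableSpace Ω] {q : ℕ}
    (Y : Ω → EuclideanSpace ℝ (Fin q)) (P : Measure Ω) : (covarianceMatrix Y P).IsHermitian := by
  ext i j
  simp [covarianceMatrix, covariance_comm]

/-- Jensen's inequality for the logarithm: for a given total variance, the capacity bound is largest
when the variance is spread evenly. -/
theorem sum_log_one_add_div_le {ι : Type*} [Fintype ι] {x : ι → ℝ} (hx : ∀ i, 0 ≤ x i) {v : ℝ}
    (hv : 0 < v) {s : ℝ} (hs : ∑ i, x i ≤ s) :
    ∑ i, Real.log (1 + x i / v) ≤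
      Fintype.card ι * Real.log (1 + s / (Fintype.card ι * v)) := by
  rcases isEmpty_or_nonempty ι with h | h
  · simp
  have hn : (0 : ℝ) < Fintype.card ι := by exact_mod_cast Fintype.card_pos
  have hpos : ∀ i, 0 < 1 + x i / v := fun i => by have := div_nonneg (hx i) hv.le; linarith
  have hsum : 0 ≤ ∑ i, x i := Finset.sum_nonneg fun i _ => hx i
  have hJ := strictConcaveOn_log_Ioi.concaveOn.le_map_sum (t := Finset.univ)
    (w := fun _ : ι => (Fintype.card ι : ℝ)⁻¹) (p := fun i => 1 + x i / v)
    (fun _ _ => by positivity) (by simp [hn.ne']) fun i _ => hpos i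
  simp only [smul_eq_mul] at hJ
  rw [← Finset.mul_sum, ← Finset.mul_sum, Finset.sum_add_distrib, ← Finset.sum_div] at hJ
  simp only [Finset.sum_const, Finset.card_univ, nsmul_eq_mul, mul_one] at hJ
  rw [inv_mul_le_iff₀ hn] at hJ
  refine hJ.trans (mul_le_mul_of_nonneg_left (Real.log_le_log (by positivity) ?_) hn.le)
  rw [mul_add, inv_mul_cancel₀ hn.ne', inv_mul_eq_div, div_div, mul_comm v]
  gcongr

/-! ### Selection based on a noisy summary -/

/-- If `g` is independent of `f` and `h` is independent of `(f, g)`, then `f` and `h` are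
independent and `g` is independent of `(f, h)`. The independence of `f` and `h` is stated through
their joint law. -/
theorem map_prodMk_and_indepFun_prodMk {Ω α β γ : Type*} [MeasurableSpace Ω]
    [MeasurableSpace α] [MeasurableSpace β] [MeasurableSpace γ] {P : Measure Ω}
    [IsProbabilityMeasure P] {f : Ω → α} {g : Ω → β} {h : Ω → γ} (hf : Measurable f)
    (hg : Measurable g) (hh : Measurable h) (hgf : IndepFun g f P)
    (hh_indep : IndepFun h (fun ω => (f ω, g ω)) P) :
    P.map (fun ω => (f ω, h ω)) = (P.map f).prod (P.map h) ∧
      IndepFun (fun ω => (f ω, h ω)) g P := by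
  have := Measure.isProbabilityMeasure_map (μ := P) hf.aemeasurable
  have := Measure.isProbabilityMeasure_map (μ := P) hg.aemeasurable
  have := Measure.isProbabilityMeasure_map (μ := P) hh.aemeasurable
  have hfh : P.map (fun ω => (f ω, h ω)) = (P.map f).prod (P.map h) :=
    (indepFun_iff_map_prod_eq_prod_map_map hf.aemeasurable hh.aemeasurable).1
      (hh_indep.comp measurable_id measurable_fst).symm
  refine ⟨hfh, ?_⟩
  have hfg := (indepFun_iff_map_prod_eq_prod_map_map hf.aemeasurable hg.aemeasurable).1 hgf.symm
  have hall := (indepFun_iff_map_prod_eq_prod_map_map hh.aemeasurable (by fun_prop)).1 hh_indep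
  rw [hfg] at hall
  rw [indepFun_iff_map_prod_eq_prod_map_map (by fun_prop) hg.aemeasurable, hfh]
  have hmp := (Measure.measurePreserving_swap (μ := P.map h) (ν := P.map f)).prod
    (MeasurePreserving.id (P.map g))
  have hmp' := hmp.comp (measurePreserving_prodAssoc (P.map h) (P.map f) (P.map g)).symm
  rw [← hmp'.map_eq, ← hall, Measure.map_map hmp'.measurable (by fun_prop)]
  rfl

theorem prod_prod_real_le_of_forall_slice {α β γ : Type*} [MeasurableSpace α] [MeasurableSpace β]
    [MeasurableSpace γ] (μ : Measure α) (ρ : Measure β) (ν : Measure γ) [IsProbabilityMeasure μ]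
    [IsProbabilityMeasure ρ] [IsProbabilityMeasure ν] {B : Set ((α × β) × γ)}
    (hB : MeasurableSet B) {a : ℝ} (h : ∀ y z, μ.real {x | ((x, y), z) ∈ B} ≤ a) :
    ((μ.prod ρ).prod ν).real B ≤ a := by
  obtain ⟨p⟩ : Nonempty (β × γ) := (ρ.prod ν).nonempty_of_neZero
  have ha : 0 ≤ a := measureReal_nonneg.trans (h p.1 p.2)
  have hmp := (measurePreserving_prodAssoc μ ρ ν).symm
  refine ENNReal.toReal_le_of_le_ofReal ha ?_
  rw [← hmp.measure_preimage hB.nullMeasurableSet,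
    Measure.prod_apply_symm (hmp.measurable hB)]
  refine (lintegral_mono (g := fun _ => ENNReal.ofReal a) fun p => ?_).trans (by simp)
  rw [← ofReal_measureReal]
  exact ENNReal.ofReal_le_ofReal (h p.1 p.2)

/-- The noncoverage bound in the coordinates of an arbitrary orthonormal basis `b`, for a set `N` of
pairs (object, data). When the observation is replaced by one drawn independently of the data,
whatever its law, the selected object is independent of the data and lies in `N` with them with
probability at most `α`; the square root accounts for the dependence. -/
theorem selection_noncoverage_le_of_orthonormalBasis {Ω 𝓓 𝓤 𝓢 : Type*} [MeasurableSpace Ω]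
    [MeasurableSpace 𝓓] [MeasurableSpace 𝓤] [MeasurableSpace 𝓢] (P : Measure Ω)
    [IsProbabilityMeasure P] {q : ℕ}
    (D : Ω → 𝓓) (hD : Measurable D) {N : Set (𝓢 × 𝓓)} (hN : MeasurableSet N)
    (T : 𝓓 → EuclideanSpace ℝ (Fin q)) (hT : Measurable T) (τ : ℝ) (hτ : 0 < τ)
    (ξ : Ω → EuclideanSpace ℝ (Fin q)) (hξ : Measurable ξ)
    (hξ_law : P.map ξ = multivariateGaussian 0 (τ ^ 2 • (1 : Matrix (Fin q) (Fin q) ℝ)))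
    (hξD : IndepFun ξ D P)
    (U : Ω → 𝓤) (hU : Measurable U) (hU_indep : IndepFun U (fun ω => (D ω, ξ ω)) P)
    (A : EuclideanSpace ℝ (Fin q) × 𝓤 → 𝓢) (hA : Measurable A)
    (hcov : MemLp (fun ω => T (D ω)) 2 P) (α : ℝ)
    (hα : ∀ s : 𝓢, P.real {ω | (s, D ω) ∈ N} ≤ α)
    (b : OrthonormalBasis (Fin q) ℝ (EuclideanSpace ℝ (Fin q))) :
    P.real {ω | (noisySelection D T ξ U A ω, D ω) ∈ N} ≤
      α + √((1 / 4) * ∑ i, Real.log (1 + Var[fun ω => inner ℝ (b i) (T (D ω)); P] / τ ^ 2)) := by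
  set G : Measure (Fin q → ℝ) := Measure.pi fun _ => gaussianReal 0 (τ ^ 2).toNNReal
  have hv : (τ ^ 2).toNNReal ≠ 0 := by simpa using hτ.ne'
  have hvr : ((τ ^ 2).toNNReal : ℝ) = τ ^ 2 := Real.coe_toNNReal _ (sq_nonneg τ)
  let X : 𝓓 × 𝓤 → Fin q → ℝ := fun y i => inner ℝ (b i) (T y.1)
  let Z : Ω → Fin q → ℝ := fun ω i => inner ℝ (b i) (ξ ω)
  have hX : Measurable X := by fun_prop
  have hZ : Measurable Z := by fun_prop
  have hDU : Measurable fun ω => (D ω, U ω) := by fun_prop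
  have := Measure.isProbabilityMeasure_map (μ := P) hD.aemeasurable
  have := Measure.isProbabilityMeasure_map (μ := P) hU.aemeasurable
  have := Measure.isProbabilityMeasure_map (μ := P) hDU.aemeasurable
  have hZ_law : P.map Z = G := by
    have hc : Measurable fun x : EuclideanSpace ℝ (Fin q) => fun i => inner ℝ (b i) x := by
      fun_prop
    have h1 : P.map Z = (P.map ξ).map fun x i => inner ℝ (b i) x := by
      rw [Measure.map_map hc hξ]; rfl
    rw [h1, hξ_law, multivariateGaussian_smul_one_eq_map_pi b hτ.le,
      Measure.map_map hc (by fun_prop)]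
    convert Measure.map_id
    ext x i
    simp [inner_sum, inner_smul_right, b.inner_eq_ite]
  obtain ⟨hDU_law, hind⟩ := map_prodMk_and_indepFun_prodMk hD hξ hU hξD hU_indep
  have hindZ : IndepFun (fun ω => (D ω, U ω)) Z P :=
    hind.comp (φ := id) (ψ := fun x i => inner ℝ (b i) x) measurable_id (by fun_prop)
  have hjoint := (indepFun_iff_map_prod_eq_prod_map_map hDU.aemeasurable hZ.aemeasurable).1 hindZ
  rw [hZ_law] at hjoint
  have hX2 : ∀ i, MemLp (fun y => X y i) 2 (P.map fun ω => (D ω, U ω)) := fun i => by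
    rw [memLp_map_measure_iff (by fun_prop) hDU.aemeasurable]
    exact hcov.const_inner (b i)
  have hVar : ∀ i, Var[fun y => X y i; P.map fun ω => (D ω, U ω)] =
      Var[fun ω => inner ℝ (b i) (T (D ω)); P] := fun i => by
    rw [variance_map (by fun_prop) hDU.aemeasurable]; rfl
  obtain ⟨γ, hγ, hbound⟩ := map_prod_add_pi_gaussianReal_real_le _ hX hX2 hv
  let φ : (𝓓 × 𝓤) × (Fin q → ℝ) → 𝓢 × 𝓓 := fun p => (A (∑ i, p.2 i • b i, p.1.2), p.1.1)
  have hφ : Measurable φ := by fun_prop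
  have hB := hφ hN
  have key := hbound _ hB
  -- Conditionally on the randomization and the independent observation, the selection is fixed.
  have hindep : ((P.map fun ω => (D ω, U ω)).prod γ).real (φ ⁻¹' N) ≤ α := by
    rw [hDU_law]
    refine prod_prod_real_le_of_forall_slice _ _ _ hB fun u x => ?_
    have hs : MeasurableSet {d | ((d, u), x) ∈ φ ⁻¹' N} :=
      (hφ.comp (by fun_prop : Measurable fun d : 𝓓 => ((d, u), x))) hN
    rw [map_measureReal_apply hD hs]
    exact hα (A (∑ i, x i • b i, u))
  have hevent : {ω | (noisySelection D T ξ U A ω, D ω) ∈ N} =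
      (fun ω => ((D ω, U ω), Z ω)) ⁻¹' ((fun p => (p.1, X p.1 + p.2)) ⁻¹' (φ ⁻¹' N)) := by
    ext ω
    have : ∑ i, (X (D ω, U ω) + Z ω) i • b i = T (D ω) + ξ ω := by
      simp only [X, Z, Pi.add_apply, ← inner_add_right]
      exact b.sum_repr' _
    simp only [Set.mem_ofPred_eq, Set.mem_preimage, φ, noisySelection, this]
  have hadd : Measurable fun p : (𝓓 × 𝓤) × (Fin q → ℝ) => (p.1, X p.1 + p.2) := by fun_prop
  rw [← hjoint, map_measureReal_apply hadd hB,
    map_measureReal_apply (by fun_prop) (hadd hB), ← hevent, hvr] at key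
  simp_rw [hVar] at key
  linarith

theorem proposition2 {Ω 𝓓 𝓤 𝓢 : Type*} [MeasurableSpace Ω] [MeasurableSpace 𝓓]
    [MeasurableSpace 𝓤] [MeasurableSpace 𝓢] (P : Measure Ω) [IsProbabilityMeasure P] {q : ℕ}
    -- the data, the targets, and the confidence sets
    (D : Ω → 𝓓) (hD : Measurable D)
    (θ : 𝓢 → ℝ) (C : 𝓢 → 𝓓 → Set ℝ)
    (hC : MeasurableSet {p : 𝓢 × 𝓓 | θ p.1 ∉ C p.1 p.2})
    -- the summary, the Gaussian noise, the additional randomization, and the selector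
    (T : 𝓓 → EuclideanSpace ℝ (Fin q)) (hT : Measurable T)
    (τ : ℝ) (hτ : 0 < τ)
    (ξ : Ω → EuclideanSpace ℝ (Fin q)) (hξ : Measurable ξ)
    (hξ_law : P.map ξ = multivariateGaussian 0 (τ ^ 2 • (1 : Matrix (Fin q) (Fin q) ℝ)))
    (hξD : IndepFun ξ D P)
    (U : Ω → 𝓤) (hU : Measurable U) (hU_indep : IndepFun U (fun ω => (D ω, ξ ω)) P)
    (A : EuclideanSpace ℝ (Fin q) × 𝓤 → 𝓢) (hA : Measurable A)
    -- the covariance of the summary exists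
    (hcov : MemLp (fun ω => T (D ω)) 2 P)
    -- noncoverage at most `α` for each fixed target
    (α : ℝ) (hα : ∀ s : 𝓢, P.real {ω | θ s ∉ C s (D ω)} ≤ α) :
    P.real {ω | θ (noisySelection D T ξ U A ω) ∉ C (noisySelection D T ξ U A ω) (D ω)} ≤
        α + √((1 / 4) *
          Real.log (Matrix.det ((1 : Matrix (Fin q) (Fin q) ℝ) +
            (τ ^ 2)⁻¹ • covarianceMatrix (fun ω => T (D ω)) P))) ∧
    ∀ v : ℝ, (covarianceMatrix (fun ω => T (D ω)) P).trace ≤ v →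
      P.real {ω | θ (noisySelection D T ξ U A ω) ∉ C (noisySelection D T ξ U A ω) (D ω)} ≤
        α + √(((q : ℝ) / 4) * Real.log (1 + v / ((q : ℝ) * τ ^ 2))) := by
  have key := selection_noncoverage_le_of_orthonormalBasis P D hD hC T hT τ hτ ξ hξ hξ_law hξD
    U hU hU_indep A hA hcov α hα
  have hτ2 : 0 < τ ^ 2 := by positivity
  constructor
  -- In an eigenbasis of `Γ = 1 + τ⁻² Σ` the factors `1 + Var / τ²` are the eigenvalues of `Γ`.
  · have hΓ : ((1 : Matrix (Fin q) (Fin q) ℝ) +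
        (τ ^ 2)⁻¹ • covarianceMatrix (fun ω => T (D ω)) P).IsHermitian :=
      Matrix.isHermitian_one.add ((covarianceMatrix_isHermitian _ P).smul (IsSelfAdjoint.all _))
    have heig : ∀ i, 1 + Var[fun ω => inner ℝ (hΓ.eigenvectorBasis i) (T (D ω)); P] / τ ^ 2 =
        hΓ.eigenvalues i := fun i => by
      have hunit : (hΓ.eigenvectorBasis i).ofLp ⬝ᵥ (hΓ.eigenvectorBasis i).ofLp = 1 := by
        have h := real_inner_self_eq_norm_sq (hΓ.eigenvectorBasis i)
        rw [hΓ.eigenvectorBasis.norm_eq_one, one_pow, EuclideanSpace.inner_eq_star_dotProduct] at h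
        simpa using h
      rw [variance_inner_eq_dotProduct_covarianceMatrix hcov, hΓ.eigenvalues_eq]
      simp [Matrix.add_mulVec, Matrix.smul_mulVec, dotProduct_add, hunit, div_eq_inv_mul]
    have hpos : ∀ i, hΓ.eigenvalues i ≠ 0 := fun i => by
      rw [← heig i]
      have := div_nonneg (variance_nonneg
        (fun ω => inner ℝ (hΓ.eigenvectorBasis i) (T (D ω))) P) hτ2.le
      positivity
    have h := key hΓ.eigenvectorBasis
    simp_rw [heig] at h
    rw [hΓ.det_eq_prod_eigenvalues]
    simpa [Real.log_prod fun i _ => hpos i] using h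
  -- In the standard basis the variances sum to the trace.
  · intro v hv
    refine (key (EuclideanSpace.basisFun (Fin q) ℝ)).trans ?_
    refine add_le_add le_rfl (Real.sqrt_le_sqrt ?_)
    have hsum : ∑ i, Var[fun ω => inner ℝ (EuclideanSpace.basisFun (Fin q) ℝ i) (T (D ω)); P]
        ≤ v := by
      refine hv.trans' (Finset.sum_le_sum fun i _ => ?_)
      rw [variance_inner_eq_dotProduct_covarianceMatrix hcov]
      simp
    have := sum_log_one_add_div_le (fun i => variance_nonneg _ P) hτ2 hsum
    rw [Fintype.card_fin] at this
    linarith
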